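/- Let $N\ge 2$. Put $\overline{1}=2$, $\overline{2}=1$, and define the Mermin–Klyshko coefficients $\gamma_{(s_1,\dots,s_N)}$, $s_i\in\{1,2\}$, by $\gamma_{(1,1)}=\gamma_{(1,2)}=\gamma_{(2,1)}=1$, $\gamma_{(2,2)}=-1$ and $$\gamma_{(s_1,\dots,s_n)}=\gamma_{(s_1,\dots,s_{n-1})}+(\delta_{s_n,1}-\delta_{s_n,2})\,\gamma_{(\overline{s_1},\dots,\overline{s_{n-1}})},\qquad 3\le n\le N .$$ For $\eta_n=(\eta_n^{(1)},\eta_n^{(2)})\in\mathbb R^2$ let $F_N^{(\gamma)}(\eta_1,\dots,\eta_N)=\sum_{s_1,\dots,s_N}\gamma_{(s_1,\dots,s_N)}\,\eta_1^{(s_1)}\cdots\eta_N^{(s_N)}$. A $2\times\cdots\times2$-setting experiment with outcome spaces $\Lambda_n^{(s)}$ ($1\le n\le N$, $s=1,2$) is a family of probability measures $P_{(s_1,\dots,s_N)}$ on $\Lambda_1^{(s_1)}\times\cdots\times\Lambda_N^{(s_N)}$. It admits an LHV model if there are a probability space $(\Omega,\nu)$ and Markov kernels $P_n^{(s)}(\cdot\mid\omega)$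 from $\Omega$ to $\Lambda_n^{(s)}$ such that $P_{(s_1,\dots,s_N)}(A_1\times\cdots\times A_N)=\int\prod_n P_n^{(s_n)}(A_n\mid\omega)\,\nu(d\omega)$ for all settings and all measurable $A_n$. For $\Lambda_n^{(s)}\subseteq\mathbb R$ bounded, $\langle\lambda_1^{(s_1)}\cdots\lambda_N^{(s_N)}\rangle$ is the expectation of the product of the outcomes under $P_{(s_1,\dots,s_N)}$. 1. $\displaystyle\max_{(\eta_1,\dots,\eta_N)\in\{-1,1\}^{2N}}\bigl|F_N^{(\gamma)}(\eta_1,\dots,\eta_N)\bigr|=2^{N-1}$. 2. For every $2\times\cdots\times2$-setting experiment with outcome sets $\Lambda_n^{(s)}\subseteq[-1,1]$ (discrete or not) that admits an LHV model, $$\Bigl|\sum_{s_1,\dots,s_N}\gamma_{(s_1,\dots,s_N)}\langle\lambda_1^{(s_1)}\cdots\lambda_N^{(s_N)}\rangle\Bigr|\le 2^{N-1}.$$ The bound is tight: if $\inf\Lambda_n^{(s)}=-1$ and $\sup\Lambda_n^{(s)}=1$ for all $n,s$, then $2^{N-1}$ is the least upper bound of the left-hand side over all experiments with these outcome sets that admit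 an LHV model. Now let $\mathcal H_1,\dots,\mathcal H_N$ be complex Hilbert spaces, possibly infinite dimensional, $\mathcal H_1\otimes\cdots\otimes\mathcal H_N$ their Hilbert space tensor product, and $\rho$ a state on it (a positive operator of trace one). For bounded operators $X_n^{(1)},X_n^{(2)}$ on $\mathcal H_n$ let $\mathcal B_1=X_1^{(1)}$ and, for $2\le n\le N$, $$\mathcal B_n=\mathcal B_{n-1}\otimes(X_n^{(1)}+X_n^{(2)})+\widetilde{\mathcal B}_{n-1}\otimes(X_n^{(1)}-X_n^{(2)}),$$ where $\widetilde{\mathcal B}_{n}$ is $\mathcal B_{n}$ with $X_k^{(1)}$ and $X_k^{(2)}$ interchanged for all $k\le n$. If $\mathrm M_n^{(s)}$ are normalized positive operator-valued (POV) measures on $\Lambda_n^{(s)}$ with values in the bounded operators on $\mathcal H_n$, the experiment performed on $\rho$ with these measurements is the one with $P_{(s_1,\dots,s_N)}(A_1\times\cdots\times A_N)=\mathrm{tr}[\rho\,(\mathrm M_1^{(s_1)}(A_1)\otimes\cdots\otimes\mathrm M_N^{(s_N)}(A_N))]$. 3. If an experiment performed on $\rho$, with outcome sets $\Lambda_n^{(s)}\subseteq[-1,1]$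 and POV measures $\mathrm M_n^{(s)}$, admits an LHV model, then for the observables $X_n^{(s)}=\int\lambda\,\mathrm M_n^{(s)}(d\lambda)$ the trace $\mathrm{tr}[\rho\,\mathcal B_N]$ exists and $|\mathrm{tr}[\rho\,\mathcal B_N]|\le 2^{N-1}$. 4. If $\rho$ admits the $2\times\cdots\times2$-setting LHV description, that is, if every $2\times\cdots\times2$-setting experiment performed on $\rho$ with POV measures admits an LHV model, then the trace $\mathrm{tr}[\rho\,\mathcal B_N]$ exists and $|\mathrm{tr}[\rho\,\mathcal B_N]|\le 2^{N-1}$ for arbitrary self-adjoint $X_n^{(s)}$ with $\|X_n^{(s)}\|\le 1$, not necessarily dichotomic. -/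

import Mathlib

open MeasureTheory ProbabilityTheory
open scoped TensorProduct

noncomputable section

/-! ### Mermin–Klyshko coefficients

The two settings at a site are the elements of `Fin 2` (`0` is the first setting, `1` the second);
`Fin.rev` interchanges them. -/

/-- The Mermin–Klyshko coefficients of `N` parties, for `N ≥ 2`: the CHSH matrix for `N = 2`, then
the recursion that appends the last party. The values for `N = 0, 1` are irrelevant. -/
def mkCoeff : (N : ℕ) → (Fin N → Fin 2) → ℝ
  | 0, _ => 0
  | 1, _ => 0
  | 2, s => if s 0 = 1 ∧ s 1 = 1 then -1 else 1
  | n + 3, s =>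
      mkCoeff (n + 2) (fun i => s i.castSucc) +
        (if s (Fin.last (n + 2)) = 0 then 1 else -1) *
          mkCoeff (n + 2) (fun i => (s i.castSucc).rev)

/-- The `N`-linear form of the vectors `η n ∈ ℝ²` with coefficients `γ`. -/
def linForm {N : ℕ} (γ : (Fin N → Fin 2) → ℝ) (η : Fin N → Fin 2 → ℝ) : ℝ :=
  ∑ s : Fin N → Fin 2, γ s * ∏ n, η n (s n)

/-! ### Correlation experiments with two settings per site and LHV models

`Λ n s` is the outcome space of the `s`-th measurement at site `n`. An experiment is a family `P` of
probability measures: `P s` is the joint distribution of the outcomes of the joint measurement with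
settings `s`. -/

/-- A local hidden variable model: one probability space `(Ω, ν)` and, for every measurement at
every site, a conditional distribution of its outcome given the hidden variable, such that each
joint distribution is the mixture of the product distributions. -/
def AdmitsLHV.{w, v} {N : ℕ} (Λ : Fin N → Fin 2 → Type v) [∀ n s, MeasurableSpace (Λ n s)]
    (P : (s : Fin N → Fin 2) → Measure ((n : Fin N) → Λ n (s n))) : Prop :=
  ∃ (Ω : Type w) (_ : MeasurableSpace Ω) (ν : Measure Ω) (K : (n : Fin N) → (s : Fin 2) →
      Kernel Ω (Λ n s)),
    IsProbabilityMeasure ν ∧ (∀ n s, IsMarkovKernel (K n s)) ∧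
    ∀ (s : Fin N → Fin 2) (A : (n : Fin N) → Set (Λ n (s n))), (∀ n, MeasurableSet (A n)) →
      P s (Set.univ.pi A) = ∫⁻ ω, ∏ n, K n (s n) ω (A n) ∂ν

/-- The full correlation function of the joint measurement with settings `s` (real outcomes). -/
def corr {N : ℕ} (Λ : Fin N → Fin 2 → Set ℝ)
    (P : (s : Fin N → Fin 2) → Measure ((n : Fin N) → Λ n (s n))) (s : Fin N → Fin 2) : ℝ :=
  ∫ x, ∏ n, (x n : ℝ) ∂(P s)

/-! ### Hilbert space tensor products -/

/-- A complex Hilbert space. -/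
structure HilbertSp.{u} where
  carrier : Type u
  [nacg : NormedAddCommGroup carrier]
  [ips : InnerProductSpace ℂ carrier]
  [complete : CompleteSpace carrier]

instance HilbertSp.instCoeSort.{u} : CoeSort HilbertSp.{u} (Type u) := ⟨HilbertSp.carrier⟩

attribute [instance] HilbertSp.nacg HilbertSp.ips HilbertSp.complete

/-- Bounded operators on a Hilbert space. -/
abbrev HilbertSp.Op.{u} (H : HilbertSp.{u}) : Type u := H →L[ℂ] H

/-- The Hilbert space tensor product: the completion of the algebraic tensor product with respect
to `⟪a ⊗ b, c ⊗ d⟫ = ⟪a, c⟫ ⟪b, d⟫`. -/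
def HilbertSp.tensor.{u} (H K : HilbertSp.{u}) : HilbertSp.{u} where
  carrier := UniformSpace.Completion (H ⊗[ℂ] K)

/-- `A ⊗ B` as a bounded operator on the Hilbert space tensor product. -/
def HilbertSp.opTensor.{u} {H K : HilbertSp.{u}} (A : H.Op) (B : K.Op) : (H.tensor K).Op :=
  (TensorProduct.mapL A B).completion

/-- `H₁ ⊗ ⋯ ⊗ H_N` (it is one-dimensional for `N = 0`). -/
def tensorSpace.{u} : (N : ℕ) → (Fin N → HilbertSp.{u}) → HilbertSp.{u}
  | 0, _ => ⟨EuclideanSpace ℂ PUnit.{u + 1}⟩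
  | 1, H => H 0
  | n + 2, H => (tensorSpace (n + 1) (fun i => H i.castSucc)).tensor (H (Fin.last (n + 1)))

/-- `A₁ ⊗ ⋯ ⊗ A_N` (it is the identity for `N = 0`). -/
def tensorOp.{u} : (N : ℕ) → (H : Fin N → HilbertSp.{u}) → ((n : Fin N) → (H n).Op) →
    (tensorSpace N H).Op
  | 0, _, _ => ContinuousLinearMap.id ℂ _
  | 1, _, A => A 0
  | n + 2, H, A =>
      HilbertSp.opTensor (tensorOp (n + 1) (fun i => H i.castSucc) (fun i => A i.castSucc))
        (A (Fin.last (n + 1)))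

/-- The Bell operator of the observables `X n s`, by recursion on the number of sites `N ≥ 1`; the
tensor factor of each new site stands last. The value for `N = 0` is irrelevant. -/
def bellOp.{u} : (N : ℕ) → (H : Fin N → HilbertSp.{u}) → ((n : Fin N) → Fin 2 → (H n).Op) →
    (tensorSpace N H).Op
  | 0, _, _ => 0
  | 1, _, X => X 0 0
  | n + 2, H, X =>
      HilbertSp.opTensor
        (bellOp (n + 1) (fun i => H i.castSucc) (fun i s => X i.castSucc s))
        (X (Fin.last (n + 1)) 0 + X (Fin.last (n + 1)) 1) +
      HilbertSp.opTensor
        (bellOp (n + 1) (fun i => H i.castSucc) (fun i s => X i.castSucc s.rev))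
        (X (Fin.last (n + 1)) 0 - X (Fin.last (n + 1)) 1)

/-! ### Traces, states, positive operator-valued measures -/

/-- `T` has the (basis-independent, unconditionally convergent) trace `z`. -/
def HasTrace.{u} {H : HilbertSp.{u}} (T : H.Op) (z : ℂ) : Prop :=
  ∀ (ι : Type u) (b : HilbertBasis ι ℂ H), HasSum (fun i => inner ℂ (b i) (T (b i))) z

/-- A quantum state: a positive operator of trace one. -/
def IsState.{u} {H : HilbertSp.{u}} (ρ : H.Op) : Prop :=
  ρ.IsPositive ∧ HasTrace ρ 1

/-- A normalized positive operator-valued measure on `Λ`; only its values on measurable sets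
matter. -/
structure POVM.{u, v} (Λ : Type v) [MeasurableSpace Λ] (H : HilbertSp.{u}) where
  toFun : Set Λ → H.Op
  isPositive : ∀ A, MeasurableSet A → (toFun A).IsPositive
  map_univ : toFun Set.univ = 1
  hasSum_iUnion : ∀ A : ℕ → Set Λ, (∀ k, MeasurableSet (A k)) →
    Pairwise (fun i j => Disjoint (A i) (A j)) →
      ∀ ψ : H, HasSum (fun k => toFun (A k) ψ) (toFun (⋃ k, A k) ψ)

namespace POVM

variable {Λ : Type*} [MeasurableSpace Λ] {H : HilbertSp}

theorem apply_empty (M : POVM Λ H) (ψ : H) : M.toFun ∅ ψ = 0 := by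
  have h := M.hasSum_iUnion (fun _ => ∅) (fun _ => MeasurableSet.empty) (fun _ _ _ => by simp) ψ
  exact (summable_const_iff (β := ℕ) _).mp h.summable

/-- The measure `A ↦ ⟪ψ, M(A) ψ⟫`. -/
def measure (M : POVM Λ H) (ψ : H) : Measure Λ :=
  Measure.ofMeasurable (fun A _ => ENNReal.ofReal (inner ℂ ψ (M.toFun A ψ)).re)
    (by simp [M.apply_empty ψ])
    (by
      intro A hA hd
      have h := M.hasSum_iUnion A hA hd ψ
      have h1 : HasSum (fun k => inner ℂ ψ (M.toFun (A k) ψ))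
          (inner ℂ ψ (M.toFun (⋃ k, A k) ψ)) := (innerSL ℂ ψ).hasSum h
      have h2 := Complex.hasSum_re h1
      rw [← h2.tsum_eq, ENNReal.ofReal_tsum_of_nonneg _ h2.summable]
      intro k
      exact (M.isPositive _ (hA k)).re_inner_nonneg_right ψ)

theorem measure_apply (M : POVM Λ H) (ψ : H) {A : Set Λ} (hA : MeasurableSet A) :
    M.measure ψ A = ENNReal.ofReal (inner ℂ ψ (M.toFun A ψ)).re :=
  Measure.ofMeasurable_apply A hA

/-- `X = ∫ λ M(dλ)`, in the weak sense, for a measure `M` on a set of real numbers; this determines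
the bounded operator `X`. -/
def IsMean {Λ : Set ℝ} (M : POVM Λ H) (X : H.Op) : Prop :=
  ∀ ψ : H, inner ℂ ψ (X ψ) = ((∫ x, (x : ℝ) ∂(M.measure ψ) : ℝ) : ℂ)

end POVM

/-! ### Quantum correlation experiments -/

/-- `P` consists of the joint distributions `tr[ρ (M₁ ⊗ ⋯ ⊗ M_N)]` of the measurements `M n s` in
the state `ρ`. -/
def IsQuantumExperiment.{u, v} {N : ℕ} {H : Fin N → HilbertSp.{u}} (ρ : (tensorSpace N H).Op)
    (Λ : Fin N → Fin 2 → Type v) [∀ n s, MeasurableSpace (Λ n s)]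
    (M : (n : Fin N) → (s : Fin 2) → POVM (Λ n s) (H n))
    (P : (s : Fin N → Fin 2) → Measure ((n : Fin N) → Λ n (s n))) : Prop :=
  ∀ (s : Fin N → Fin 2) (A : (n : Fin N) → Set (Λ n (s n))), (∀ n, MeasurableSet (A n)) →
    HasTrace (ρ ∘L tensorOp N H (fun n => (M n (s n)).toFun (A n)))
      (((P s).real (Set.univ.pi A) : ℝ) : ℂ)

/-- `ρ` admits the `2 × ⋯ × 2`-setting LHV description: every correlation experiment on `ρ` with two
generalized measurements per site admits an LHV model. -/
def StateAdmitsLHV.{u, w} {N : ℕ} {H : Fin N → HilbertSp.{u}} (ρ : (tensorSpace N H).Op) : Prop :=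
  ∀ (Λ : Fin N → Fin 2 → Type) [∀ n s, MeasurableSpace (Λ n s)]
    (M : (n : Fin N) → (s : Fin 2) → POVM (Λ n s) (H n))
    (P : (s : Fin N → Fin 2) → Measure ((n : Fin N) → Λ n (s n))),
    (∀ s, IsProbabilityMeasure (P s)) → IsQuantumExperiment ρ Λ M P → AdmitsLHV.{w} Λ P

end

universe u w

/-! ### The coefficients and the multilinear form -/

/-! The scalar core is one inequality: if |a|, |b| ≤ M and |x|, |y| ≤ 1, then |a(x + y) + b(x - y)|
≤ 2M, because |a + b| + |a - b| = 2 max(|a|, |b|). The recursion for the coefficients turns the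
N-linear form into exactly this shape (`linForm_succ`), so induction bounds it by 2^(N-1) on the
whole cube [-1, 1]^(2N), and the all-ones point attains the bound.

Given the hidden variable, the outcomes are independent. Each correlation is therefore the average
of a product of conditional means, and the Bell sum is the average of the form over points of the
cube (`abs_sum_mkCoeff_mul_corr_le`). Deterministic models with outcomes tending to 1 give
tightness.

For the quantum statements, write ρ = R² with R Hilbert–Schmidt. Then T ↦ tr[ρT] is a bounded
positive functional φ on all bounded operators (`IsState.exists_functional`), which settles
existence of the trace. The Bell operator expands with the same coefficients (`bellOp_eq_sum`), and
φ of a product of means is a correlation: this is immediate for step functions of the outcomes, and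
the general case follows by norm approximation (`functional_tensorOp_mean`). Finally, a self-adjoint
contraction X is the mean of the ±1-valued measurement with effects (1 ± X)/2, so no spectral
measure is needed and arbitrary observables reduce to the experimental inequality. -/

theorem sum_settings_succ {M : Type*} [AddCommMonoid M] {n : ℕ} (f : (Fin (n + 1) → Fin 2) → M) :
    ∑ s, f s = ∑ t : Fin n → Fin 2, (f (Fin.snoc t 0) + f (Fin.snoc t 1)) := by
  rw [← (Fin.snocEquiv (fun _ : Fin (n + 1) => Fin 2)).sum_comp, Fintype.sum_prod_type,
    Fin.sum_univ_two, ← Finset.sum_add_distrib]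
  rfl

theorem sum_settings_rev {M : Type*} [AddCommMonoid M] {n : ℕ} (f : (Fin n → Fin 2) → M) :
    ∑ s : Fin n → Fin 2, f (fun i => (s i).rev) = ∑ s, f s :=
  (Equiv.piCongrRight fun _ : Fin n => Fin.revPerm (n := 2)).sum_comp f

theorem mkCoeff_snoc_zero {n : ℕ} (t : Fin (n + 2) → Fin 2) :
    mkCoeff (n + 3) (Fin.snoc (α := fun _ => Fin 2) t 0) =
      mkCoeff (n + 2) t + mkCoeff (n + 2) (fun i => (t i).rev) := by
  simp [mkCoeff]

theorem mkCoeff_snoc_one {n : ℕ} (t : Fin (n + 2) → Fin 2) :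
    mkCoeff (n + 3) (Fin.snoc (α := fun _ => Fin 2) t 1) =
      mkCoeff (n + 2) t - mkCoeff (n + 2) (fun i => (t i).rev) := by
  simp [mkCoeff, sub_eq_add_neg]

/-- Moves the interchange of settings from the coefficients to the vectors, the form in which the
induction hypothesis applies. -/
theorem linForm_rev {N : ℕ} (γ : (Fin N → Fin 2) → ℝ) (η : Fin N → Fin 2 → ℝ) :
    linForm (fun s => γ (fun i => (s i).rev)) η = linForm γ (fun i s => η i s.rev) := by
  rw [linForm, ← sum_settings_rev]
  simp [linForm]

theorem linForm_two (η : Fin 2 → Fin 2 → ℝ) :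
    linForm (mkCoeff 2) η = η 0 0 * (η 1 0 + η 1 1) + η 0 1 * (η 1 0 - η 1 1) := by
  simp only [linForm, sum_settings_succ, Finset.univ_unique, Finset.sum_singleton,
    Fin.prod_univ_two]
  simp [mkCoeff, Fin.snoc]
  ring

theorem linForm_succ {n : ℕ} (η : Fin (n + 3) → Fin 2 → ℝ) :
    linForm (mkCoeff (n + 3)) η =
      linForm (mkCoeff (n + 2)) (fun i => η i.castSucc) *
          (η (Fin.last (n + 2)) 0 + η (Fin.last (n + 2)) 1) +
        linForm (mkCoeff (n + 2)) (fun i s => η i.castSucc s.rev) *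
          (η (Fin.last (n + 2)) 0 - η (Fin.last (n + 2)) 1) := by
  rw [← linForm_rev (mkCoeff (n + 2)) (fun i => η i.castSucc)]
  simp only [linForm, sum_settings_succ (n := n + 2), mkCoeff_snoc_zero, mkCoeff_snoc_one,
    Fin.prod_univ_castSucc (n := n + 2), Fin.snoc_castSucc, Fin.snoc_last, Finset.sum_mul,
    ← Finset.sum_add_distrib]
  refine Finset.sum_congr rfl fun t _ => ?_
  ring

/-- Regrouping by x and y leaves |a + b| + |a - b|, which is 2 max(|a|, |b|). -/
theorem abs_mul_add_mul_sub_le {a b x y M : ℝ} (ha : |a| ≤ M) (hb : |b| ≤ M) (hx : |x| ≤ 1)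
    (hy : |y| ≤ 1) : |a * (x + y) + b * (x - y)| ≤ M * 2 := by
  have h1 : |a + b| + |a - b| ≤ M * 2 := by
    rw [abs_le] at ha hb
    rcases abs_cases (a + b) with h | h <;> rcases abs_cases (a - b) with h' | h' <;> linarith
  calc |a * (x + y) + b * (x - y)| = |(a + b) * x + (a - b) * y| := by ring_nf
    _ ≤ |a + b| * |x| + |a - b| * |y| := by
        rw [← abs_mul, ← abs_mul]; exact abs_add_le _ _
    _ ≤ |a + b| * 1 + |a - b| * 1 := by gcongr
    _ ≤ M * 2 := by linarith

theorem abs_linForm_mkCoeff_le (n : ℕ) (η : Fin (n + 2) → Fin 2 → ℝ) (hη : ∀ i s, |η i s| ≤ 1) :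
    |linForm (mkCoeff (n + 2)) η| ≤ 2 ^ (n + 1) := by
  induction n with
  | zero =>
    rw [linForm_two]
    simpa using abs_mul_add_mul_sub_le (hη 0 0) (hη 0 1) (hη 1 0) (hη 1 1)
  | succ n ih =>
    rw [linForm_succ, pow_succ]
    exact abs_mul_add_mul_sub_le (ih _ fun i s => hη _ _) (ih _ fun i s => hη _ _) (hη _ _)
      (hη _ _)

/-- At equal settings the difference factor vanishes and the sum factor doubles the value. -/
theorem linForm_mkCoeff_one (n : ℕ) : linForm (mkCoeff (n + 2)) (fun _ _ => 1) = 2 ^ (n + 1) := by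
  induction n with
  | zero => rw [linForm_two]; norm_num
  | succ n ih => rw [linForm_succ, ih]; ring

theorem isGreatest_abs_linForm_mkCoeff (n : ℕ) :
    IsGreatest
      ((fun η : Fin (n + 2) → Fin 2 → ℝ => |linForm (mkCoeff (n + 2)) η|) ''
        {η | ∀ n s, η n s = -1 ∨ η n s = 1})
      ((2 : ℝ) ^ (n + 1)) := by
  refine ⟨⟨fun _ _ => 1, fun _ _ => Or.inr rfl, ?_⟩, ?_⟩
  · simp only [linForm_mkCoeff_one]
    exact abs_of_pos (by positivity)
  · rintro _ ⟨η, hη, rfl⟩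
    exact abs_linForm_mkCoeff_le n η fun i s => by rcases hη i s with h | h <;> simp [h]

/-! ### Correlations in a local hidden variable model -/

/-- Makes the pointwise product of the kernels a kernel; boxes form a generating π-system, so
measurability is needed only on them. -/
theorem measurable_measure_pi {ι Ω : Type*} [Fintype ι] {E : ι → Type*}
    [∀ i, MeasurableSpace (E i)] [MeasurableSpace Ω] (κ : (i : ι) → Kernel Ω (E i))
    [∀ i, IsMarkovKernel (κ i)] : Measurable fun ω => Measure.pi fun i => κ i ω := by
  refine Measurable.measure_of_isPiSystem_of_isProbabilityMeasure generateFrom_pi.symm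
    isPiSystem_pi ?_
  rintro _ ⟨A, hA, rfl⟩
  simp only [Measure.pi_pi]
  exact Finset.measurable_prod _ fun i _ => Kernel.measurable_coe _ (hA i (Set.mem_univ i))

/-- Fubini's theorem for a mixture of product measures. -/
theorem integral_prod_eq_integral_prod_integral {ι Ω : Type*} [Fintype ι] {E : ι → Type*}
    [∀ i, MeasurableSpace (E i)] [MeasurableSpace Ω] (κ : (i : ι) → Kernel Ω (E i))
    [∀ i, IsMarkovKernel (κ i)] (ν : Measure Ω) [IsProbabilityMeasure ν]
    (P : Measure ((i : ι) → E i)) [IsProbabilityMeasure P]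
    (hP : ∀ A : (i : ι) → Set (E i), (∀ i, MeasurableSet (A i)) →
      P (Set.univ.pi A) = ∫⁻ ω, ∏ i, κ i ω (A i) ∂ν)
    (f : (i : ι) → E i → ℝ) (hf : ∀ i, Measurable (f i)) (hf1 : ∀ i x, |f i x| ≤ 1) :
    ∫ x, ∏ i, f i (x i) ∂P = ∫ ω, ∏ i, ∫ x, f i x ∂(κ i ω) ∂ν := by
  let K : Kernel Ω ((i : ι) → E i) := ⟨fun ω => Measure.pi fun i => κ i ω, measurable_measure_pi κ⟩
  have : IsMarkovKernel K := ⟨fun ω => by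
    change IsProbabilityMeasure (Measure.pi fun i => κ i ω); infer_instance⟩
  -- The model prescribes `P` only on boxes; these determine it as the second marginal of `ν ⊗ₘ K`.
  have hPK : P = (ν ⊗ₘ K).snd := by
    refine ext_of_generate_finite _ generateFrom_pi.symm isPiSystem_pi ?_ (by simp)
    rintro _ ⟨A, hA, rfl⟩
    have hA' : ∀ i, MeasurableSet (A i) := fun i => hA i (Set.mem_univ i)
    rw [hP A hA', Measure.snd_compProd, Measure.bind_apply (MeasurableSet.univ_pi hA')
      (Kernel.aemeasurable _)]
    refine lintegral_congr fun ω => ?_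
    change _ = Measure.pi (fun i => κ i ω) _
    rw [Measure.pi_pi]
  have hm : Measurable fun x : (i : ι) → E i => ∏ i, f i (x i) :=
    Finset.measurable_prod _ fun i _ => (hf i).comp (measurable_pi_apply i)
  have hb : ∀ x : (i : ι) → E i, ‖∏ i, f i (x i)‖ ≤ 1 := fun x => by
    rw [norm_prod]
    exact Finset.prod_le_one (fun _ _ => norm_nonneg _) fun i _ => hf1 i _
  rw [hPK, Measure.snd, integral_map measurable_snd.aemeasurable hm.aestronglyMeasurable,
    Measure.integral_compProd]
  · refine integral_congr_ae (Filter.Eventually.of_forall fun ω => ?_)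
    exact integral_fintype_prod_eq_prod f
  · exact Integrable.of_bound (hm.comp measurable_snd).aestronglyMeasurable 1
      (Filter.Eventually.of_forall fun x => hb x.2)

theorem abs_sum_mkCoeff_mul_corr_le (n : ℕ) (Λ : Fin (n + 2) → Fin 2 → Set ℝ)
    (hΛ : ∀ n s, Λ n s ⊆ Set.Icc (-1) 1)
    (P : (s : Fin (n + 2) → Fin 2) → Measure ((n : Fin (n + 2)) → Λ n (s n)))
    (hP : ∀ s, IsProbabilityMeasure (P s)) (hL : AdmitsLHV.{w} (fun n s => Λ n s) P) :
    |∑ s, mkCoeff (n + 2) s * corr Λ P s| ≤ 2 ^ (n + 1) := by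
  obtain ⟨Ω, _, ν, K, _, hK, h⟩ := hL
  have hval : ∀ i s (x : Λ i s), |(x : ℝ)| ≤ 1 := fun i s x => abs_le.mpr (hΛ i s x.2)
  -- The conditional means form a point of the cube for each value of the hidden variable.
  let η : Ω → Fin (n + 2) → Fin 2 → ℝ := fun ω i s => ∫ x, (x : ℝ) ∂(K i s ω)
  have hη : ∀ ω i s, |η ω i s| ≤ 1 := fun ω i s => by
    simpa using norm_integral_le_of_norm_le_const (μ := K i s ω)
      (f := fun x => (x : ℝ))
      (Filter.Eventually.of_forall fun x => hval i s x)
  have hηm : ∀ i s, StronglyMeasurable fun ω => η ω i s := fun i s =>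
    (measurable_subtype_coe.stronglyMeasurable).integral_kernel
  have hc : ∀ s, corr Λ P s = ∫ ω, ∏ i, η ω i (s i) ∂ν := fun s =>
    integral_prod_eq_integral_prod_integral (fun i => K i (s i)) ν (P s) (h s)
      (fun i x => (x : ℝ)) (fun i => measurable_subtype_coe) (fun i => hval i (s i))
  have hint : ∀ s : Fin (n + 2) → Fin 2, Integrable (fun ω => ∏ i, η ω i (s i)) ν := fun s => by
    refine Integrable.of_bound (C := 1) (Finset.stronglyMeasurable_fun_prod _
      fun i _ => hηm i (s i)).aestronglyMeasurable (Filter.Eventually.of_forall fun ω => ?_)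
    rw [norm_prod]
    exact Finset.prod_le_one (fun _ _ => norm_nonneg _) fun i _ => hη ω i _
  have : ∑ s, mkCoeff (n + 2) s * corr Λ P s = ∫ ω, linForm (mkCoeff (n + 2)) (η ω) ∂ν := by
    simp only [linForm, hc]
    rw [integral_finsetSum _ fun s _ => (hint s).const_mul _]
    simp only [integral_const_mul]
  rw [this]
  simpa using norm_integral_le_of_norm_le_const (μ := ν)
    (f := fun ω => linForm (mkCoeff (n + 2)) (η ω))
    (Filter.Eventually.of_forall fun ω => abs_linForm_mkCoeff_le n _ (hη ω))

/-- Preassigned outcomes need only a one-point hidden variable space. -/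
theorem admitsLHV_pi_dirac {N : ℕ} (Λ : Fin N → Fin 2 → Set ℝ)
    (x : (n : Fin N) → (s : Fin 2) → Λ n s) :
    AdmitsLHV.{w} (fun n s => Λ n s) (fun s => Measure.pi fun n => Measure.dirac (x n (s n))) := by
  refine ⟨PUnit, inferInstance, Measure.dirac PUnit.unit,
    fun n s => Kernel.const _ (Measure.dirac (x n s)), inferInstance, fun n s => inferInstance,
    fun s A hA => ?_⟩
  simp [Measure.pi_pi]

theorem continuous_linForm {N : ℕ} (γ : (Fin N → Fin 2) → ℝ) : Continuous (linForm γ) := by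
  unfold linForm
  fun_prop

theorem isLUB_abs_sum_mkCoeff_mul_corr (n : ℕ) (Λ : Fin (n + 2) → Fin 2 → Set ℝ)
    (h0 : ∀ n s, IsGLB (Λ n s) (-1)) (h1 : ∀ n s, IsLUB (Λ n s) 1) :
    IsLUB
      {r : ℝ | ∃ P : (s : Fin (n + 2) → Fin 2) → Measure ((n : Fin (n + 2)) → Λ n (s n)),
        (∀ s, IsProbabilityMeasure (P s)) ∧ AdmitsLHV.{w} (fun n s => Λ n s) P ∧
          r = |∑ s, mkCoeff (n + 2) s * corr Λ P s|}
      (2 ^ (n + 1)) := by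
  refine ⟨?_, fun c hc => ?_⟩
  · rintro _ ⟨P, hP, hL, rfl⟩
    exact abs_sum_mkCoeff_mul_corr_le n Λ (fun i s x hx => ⟨(h0 i s).1 hx, (h1 i s).1 hx⟩) P hP hL
  · have hne : ∀ i s, (Λ i s).Nonempty := fun i s => by
      rw [Set.nonempty_iff_ne_empty]
      intro h
      have := h1 i s
      rw [h, isLUB_empty_iff] at this
      exact absurd (this 0) (by norm_num)
    -- The supremum 1 need not be attained, so outcomes converging to it are used, together with
    -- continuity of the form.
    choose x _ _ hlim hmem using fun i s => (h1 i s).exists_seq_monotone_tendsto (hne i s)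
    have hlim' : Filter.Tendsto (fun k i s => x i s k) Filter.atTop (nhds fun _ _ => (1 : ℝ)) :=
      tendsto_pi_nhds.mpr fun i => tendsto_pi_nhds.mpr fun s => hlim i s
    have h2 := ((continuous_linForm (mkCoeff (n + 2))).abs.tendsto _).comp hlim'
    rw [linForm_mkCoeff_one, abs_of_pos (by positivity)] at h2
    refine le_of_tendsto h2 (Filter.Eventually.of_forall fun k => hc
      ⟨_, fun s => inferInstance, admitsLHV_pi_dirac Λ fun i s => ⟨x i s k, hmem i s k⟩, ?_⟩)
    simp only [Function.comp, linForm]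
    congr 1
    refine Finset.sum_congr rfl fun s _ => ?_
    rw [corr, integral_fintype_prod_eq_prod (fun i (y : Λ i (s i)) => (y : ℝ))]
    simp

/-! ### Traces -/

section HilbertSchmidt

variable {E : Type*} [NormedAddCommGroup E] [InnerProductSpace ℂ E]

theorem HilbertBasis.hasSum_norm_inner_sq {κ : Type*} (c : HilbertBasis κ ℂ E) (x : E) :
    HasSum (fun j => ‖inner ℂ x (c j)‖ ^ 2) (‖x‖ ^ 2) := by
  have h := Complex.hasSum_re (c.hasSum_inner_mul_inner x x)
  have e : (inner ℂ x x).re = ‖x‖ ^ 2 := inner_self_eq_norm_sq (𝕜 := ℂ) x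
  rw [e] at h
  convert h using 2 with j
  have := inner_mul_symm_re_eq_norm (𝕜 := ℂ) x (c j)
  rw [norm_mul, norm_inner_symm (c j) x, ← sq] at this
  exact this.symm

theorem summable_prod_of_sq_summable {ι κ : Type*} (a : ι × κ → ℂ) (r : ι → ℝ) (hr : Summable r)
    (h : ∀ i, HasSum (fun j => ‖a (i, j)‖ ^ 2) (r i)) : Summable fun p => ‖a p‖ ^ 2 := by
  rw [summable_prod_of_nonneg fun _ => sq_nonneg _]
  exact ⟨fun i => (h i).summable, by simpa only [(h _).tsum_eq] using hr⟩

variable [CompleteSpace E]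

/-- The Hilbert–Schmidt inner product of two operators equals the one of their adjoints, with
respect to any pair of bases. -/
theorem exists_hasSum_inner_adjoint {ι κ : Type*} (b : HilbertBasis ι ℂ E) (c : HilbertBasis κ ℂ E)
    (A B : E →L[ℂ] E) (hA : Summable fun i => ‖A (b i)‖ ^ 2)
    (hB : Summable fun i => ‖B (b i)‖ ^ 2) :
    ∃ z : ℂ, HasSum (fun i => inner ℂ (A (b i)) (B (b i))) z ∧
      HasSum (fun j => inner ℂ (B.adjoint (c j)) (A.adjoint (c j))) z := by
  -- Both series are iterated sums of this one double series, by Parseval in `c` and in `b`. It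
  -- converges absolutely by 2st ≤ s² + t², so the order of summation is free.
  let f : ι × κ → ℂ := fun p => inner ℂ (A (b p.1)) (c p.2) * inner ℂ (c p.2) (B (b p.1))
  have h1 := summable_prod_of_sq_summable (fun p : ι × κ => inner ℂ (A (b p.1)) (c p.2)) _ hA
    fun i => c.hasSum_norm_inner_sq (A (b i))
  have h2 := summable_prod_of_sq_summable (fun p : ι × κ => inner ℂ (B (b p.1)) (c p.2)) _ hB
    fun i => c.hasSum_norm_inner_sq (B (b i))
  have hf : Summable f := by
    refine Summable.of_norm_bounded (h1.add h2) fun p => ?_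
    rw [norm_mul, norm_inner_symm (c p.2) (B (b p.1))]
    have h := two_mul_le_add_sq ‖inner ℂ (A (b p.1)) (c p.2)‖ ‖inner ℂ (B (b p.1)) (c p.2)‖
    have h' := mul_nonneg (norm_nonneg (inner ℂ (A (b p.1)) (c p.2)))
      (norm_nonneg (inner ℂ (B (b p.1)) (c p.2)))
    linarith
  have hf' : Summable fun p : κ × ι => f (p.2, p.1) := (Equiv.prodComm κ ι).summable_iff.mpr hf
  have e : ∑' p : κ × ι, f (p.2, p.1) = ∑' p, f p := (Equiv.prodComm κ ι).tsum_eq f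
  refine ⟨∑' p, f p, ?_, ?_⟩
  · exact hf.hasSum.prod_fiberwise fun i => c.hasSum_inner_mul_inner (A (b i)) (B (b i))
  · have h3 := hf'.hasSum
    rw [e] at h3
    refine h3.prod_fiberwise fun j => ?_
    have h4 := b.hasSum_inner_mul_inner (B.adjoint (c j)) (A.adjoint (c j))
    simp only [ContinuousLinearMap.adjoint_inner_left, ContinuousLinearMap.adjoint_inner_right]
      at h4 ⊢
    exact h4.congr_fun fun i => mul_comm _ _

theorem summable_norm_adjoint_sq {ι κ : Type*} (b : HilbertBasis ι ℂ E) (c : HilbertBasis κ ℂ E)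
    (A : E →L[ℂ] E) (hA : Summable fun i => ‖A (b i)‖ ^ 2) :
    Summable fun j => ‖A.adjoint (c j)‖ ^ 2 := by
  obtain ⟨z, -, h⟩ := exists_hasSum_inner_adjoint b c A A hA hA
  refine (Complex.hasSum_re h).summable.congr fun j => ?_
  exact inner_self_eq_norm_sq (𝕜 := ℂ) _

end HilbertSchmidt

/-- `HasTrace` quantifies over bases; uniqueness rests on the existence of at least one. -/
theorem HasTrace.unique {H : HilbertSp.{u}} {T : H.Op} {z z' : ℂ} (h : HasTrace T z)
    (h' : HasTrace T z') : z = z' := by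
  obtain ⟨s, b, -⟩ := exists_hilbertBasis ℂ H
  exact (h _ b).unique (h' _ b)

/-- A state has a square root whose columns in a basis represent the expectation functional. -/
theorem IsState.exists_vectors {H : HilbertSp.{u}} {ρ : H.Op} (hρ : IsState ρ) :
    ∃ (κ : Type u) (ψ : κ → H), HasSum (fun j => ‖ψ j‖ ^ 2) 1 ∧
      ∀ T : H.Op, ∃ z : ℂ, HasSum (fun j => inner ℂ (ψ j) (T (ψ j))) z ∧ HasTrace (ρ ∘L T) z := by
  obtain ⟨hpos, htr⟩ := hρ
  obtain ⟨κ, c, -⟩ := exists_hilbertBasis ℂ H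
  rw [← ContinuousLinearMap.nonneg_iff_isPositive] at hpos
  set R : H.Op := CFC.sqrt ρ
  have hR : IsSelfAdjoint R := .of_nonneg (CFC.sqrt_nonneg ρ)
  have hRR : R * R = ρ := CFC.sqrt_mul_sqrt_self ρ
  have hadj : R.adjoint = R := hR
  have hρR : ∀ x y : H, inner ℂ x (ρ y) = inner ℂ (R x) (R y) := fun x y => by
    rw [← ContinuousLinearMap.adjoint_inner_right, hadj, ← hRR]; rfl
  have hsum : ∀ (ι : Type u) (b : HilbertBasis ι ℂ H), HasSum (fun i => ‖R (b i)‖ ^ 2) 1 :=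
    fun ι b => by
      have := Complex.hasSum_re (htr ι b)
      simp only [hρR, Complex.one_re] at this
      convert this using 2 with i
      exact (inner_self_eq_norm_sq (𝕜 := ℂ) _).symm
  refine ⟨κ, fun j => R (c j), hsum _ c, fun T => ?_⟩
  have hRT : ∀ (ι : Type u) (b : HilbertBasis ι ℂ H), Summable fun i => ‖(R ∘L T) (b i)‖ ^ 2 :=
    fun ι b => by
      -- T†R is Hilbert–Schmidt since R is and T† is bounded; RT is its adjoint.
      have h1 : Summable fun i => ‖(T.adjoint ∘L R) (b i)‖ ^ 2 := by
        refine ((hsum ι b).summable.mul_left (‖T.adjoint‖ ^ 2)).of_nonneg_of_le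
          (fun _ => sq_nonneg _) fun i => ?_
        rw [← mul_pow]
        gcongr
        exact T.adjoint.le_opNorm _
      have h2 := summable_norm_adjoint_sq b b _ h1
      rwa [ContinuousLinearMap.adjoint_comp, hadj, ContinuousLinearMap.adjoint_adjoint] at h2
  -- The second series always uses the fixed basis `c`, so the value `z` cannot depend on `b`.
  have key : ∀ (ι : Type u) (b : HilbertBasis ι ℂ H), ∃ z : ℂ,
      HasSum (fun i => inner ℂ (b i) ((ρ ∘L T) (b i))) z ∧
        HasSum (fun j => inner ℂ (R (c j)) (T (R (c j)))) z := fun ι b => by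
    obtain ⟨z, hz, hz'⟩ := exists_hasSum_inner_adjoint b c R (R ∘L T) (hsum ι b).summable (hRT ι b)
    refine ⟨z, ?_, ?_⟩
    · convert hz using 2 with i
      exact hρR _ _
    · convert hz' using 2 with j
      rw [ContinuousLinearMap.adjoint_comp, hadj, ContinuousLinearMap.comp_apply,
        ContinuousLinearMap.adjoint_inner_left]
  obtain ⟨z, -, hz⟩ := key κ c
  refine ⟨z, hz, fun ι b => ?_⟩
  obtain ⟨z', h, h'⟩ := key ι b
  rwa [hz.unique h']

/-- The expectation functional `T ↦ tr[ρ T]` of a state. -/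
theorem IsState.exists_functional {H : HilbertSp.{u}} {ρ : H.Op} (hρ : IsState ρ) :
    ∃ φ : H.Op →L[ℂ] ℂ, (∀ T, HasTrace (ρ ∘L T) (φ T)) ∧
      ∀ T, T.IsPositive → 0 ≤ (φ T).re ∧ (φ T).im = 0 := by
  obtain ⟨κ, ψ, hψ, h⟩ := hρ.exists_vectors
  choose φ hφ htr using h
  refine ⟨LinearMap.mkContinuous ⟨⟨φ, fun S T => ?_⟩, fun a T => ?_⟩ 1 fun T => ?_, htr,
    fun T hT => ⟨?_, ?_⟩⟩
  · refine (hφ (S + T)).unique ?_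
    simpa [inner_add_right] using (hφ S).add (hφ T)
  · refine (hφ (a • T)).unique ?_
    simpa [inner_smul_right] using (hφ T).mul_left a
  · change ‖φ T‖ ≤ 1 * ‖T‖
    rw [← (hφ T).tsum_eq]
    -- The norm bound 1 is the trace of ρ, that is, the sum of the ‖ψ j‖².
    refine tsum_of_norm_bounded (hψ.mul_right ‖T‖) fun j => ?_
    calc ‖inner ℂ (ψ j) (T (ψ j))‖ ≤ ‖ψ j‖ * (‖T‖ * ‖ψ j‖) :=
          (norm_inner_le_norm _ _).trans (by gcongr; exact T.le_opNorm _)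
      _ = ‖ψ j‖ ^ 2 * ‖T‖ := by ring
  · exact (Complex.hasSum_re (hφ T)).nonneg fun j => hT.re_inner_nonneg_right _
  · refine (Complex.hasSum_im (hφ T)).unique ?_
    convert hasSum_zero with j
    exact hT.isSymmetric.im_inner_self_apply (ψ j)

/-! ### Tensor products of operators -/

namespace HilbertSp

variable {H K : HilbertSp.{u}}

/-- The embedding of the algebraic into the Hilbert space tensor product. -/
noncomputable def tensorIncl (H K : HilbertSp.{u}) : (H ⊗[ℂ] K) →ₗᵢ[ℂ] H.tensor K :=
  UniformSpace.Completion.toComplₗᵢ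

theorem denseRange_tensorIncl (H K : HilbertSp.{u}) : DenseRange (tensorIncl H K) :=
  UniformSpace.Completion.denseRange_coe

theorem tensor_ext {A B : (H.tensor K).Op}
    (h : ∀ x : H ⊗[ℂ] K, A (tensorIncl H K x) = B (tensorIncl H K x)) : A = B :=
  ContinuousLinearMap.ext fun x => (denseRange_tensorIncl H K).induction_on x
    (isClosed_eq A.continuous B.continuous) h

theorem opTensor_tensorIncl (A : H.Op) (B : K.Op) (x : H ⊗[ℂ] K) :
    opTensor A B (tensorIncl H K x) = tensorIncl H K (TensorProduct.mapL A B x) :=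
  ContinuousLinearMap.completion_apply_coe _ _

theorem opTensor_add_left (A A' : H.Op) (B : K.Op) :
    opTensor (A + A') B = opTensor A B + opTensor A' B :=
  tensor_ext fun x => by
    simp [opTensor_tensorIncl, TensorProduct.mapL_add_left, -TensorProduct.mapL_apply]

theorem opTensor_add_right (A : H.Op) (B B' : K.Op) :
    opTensor A (B + B') = opTensor A B + opTensor A B' :=
  tensor_ext fun x => by
    simp [opTensor_tensorIncl, TensorProduct.mapL_add_right, -TensorProduct.mapL_apply]

theorem opTensor_smul_left (a : ℂ) (A : H.Op) (B : K.Op) :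
    opTensor (a • A) B = a • opTensor A B :=
  tensor_ext fun x => by
    simp [opTensor_tensorIncl, TensorProduct.mapL_smul_left, -TensorProduct.mapL_apply]

theorem opTensor_smul_right (a : ℂ) (A : H.Op) (B : K.Op) :
    opTensor A (a • B) = a • opTensor A B :=
  tensor_ext fun x => by
    simp [opTensor_tensorIncl, TensorProduct.mapL_smul_right, -TensorProduct.mapL_apply]

theorem opTensor_sub_right (A : H.Op) (B B' : K.Op) :
    opTensor A (B - B') = opTensor A B - opTensor A B' := by
  rw [eq_sub_iff_add_eq, ← opTensor_add_right, sub_add_cancel]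

theorem opTensor_sum_smul_left {ι : Type*} (s : Finset ι) (c : ι → ℂ) (A : ι → H.Op) (B : K.Op) :
    opTensor (∑ i ∈ s, c i • A i) B = ∑ i ∈ s, c i • opTensor (A i) B := by
  simp only [← opTensor_smul_left]
  exact map_sum (AddMonoidHom.mk' (fun A : H.Op => opTensor A B)
    fun A A' => opTensor_add_left A A' B) _ _

theorem smul_opTensor_add_add_smul_opTensor_sub (a b : ℂ) (A : H.Op) (B B' : K.Op) :
    a • opTensor A (B + B') + b • opTensor A (B - B') =
      (a + b) • opTensor A B + (a - b) • opTensor A B' := by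
  rw [opTensor_add_right, opTensor_sub_right]
  module

theorem opTensor_one_one : opTensor (1 : H.Op) (1 : K.Op) = 1 :=
  tensor_ext fun x => by simp [opTensor_tensorIncl]

theorem opTensor_mul (A A' : H.Op) (B B' : K.Op) :
    opTensor (A * A') (B * B') = opTensor A B * opTensor A' B' :=
  tensor_ext fun x => by
    simp [opTensor_tensorIncl, TensorProduct.mapL_mul, -TensorProduct.mapL_apply]

theorem norm_opTensor_le (A : H.Op) (B : K.Op) : ‖opTensor A B‖ ≤ ‖A‖ * ‖B‖ := by
  refine ContinuousLinearMap.opNorm_le_bound _ (by positivity) fun x =>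
    (denseRange_tensorIncl H K).induction_on
      (p := fun x => ‖opTensor A B x‖ ≤ ‖A‖ * ‖B‖ * ‖x‖) x ?_ fun x => ?_
  · exact isClosed_le (opTensor A B).continuous.norm (continuous_const.mul continuous_norm)
  · rw [opTensor_tensorIncl, LinearIsometry.norm_map, LinearIsometry.norm_map]
    exact ((TensorProduct.mapL A B).le_opNorm x).trans
      (by gcongr; exact TensorProduct.norm_mapL_le A B)

/-- Symmetry is checked on elementary tensors, extended by linearity, then by density to the
completion. -/
theorem isSelfAdjoint_opTensor {A : H.Op} {B : K.Op} (hA : IsSelfAdjoint A)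
    (hB : IsSelfAdjoint B) : IsSelfAdjoint (opTensor A B) := by
  rw [ContinuousLinearMap.isSelfAdjoint_iff_isSymmetric] at hA hB ⊢
  have hsymm : ∀ x y : H ⊗[ℂ] K, inner ℂ (TensorProduct.mapL A B x) y =
      inner ℂ x (TensorProduct.mapL A B y) := fun x y => by
    induction x with
    | zero => simp
    | add x x' hx hx' => simp only [map_add, inner_add_left, hx, hx']
    | tmul a b =>
      induction y with
      | zero => simp
      | add y y' hy hy' => simp only [map_add, inner_add_right, hy, hy']
      | tmul c d =>
        rw [TensorProduct.mapL_tmul, TensorProduct.mapL_tmul, TensorProduct.inner_tmul,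
          TensorProduct.inner_tmul]
        exact congrArg₂ _ (hA a c) (hB b d)
  have hd := denseRange_tensorIncl H K
  refine fun x y => hd.induction_on₂
    (p := fun x y => inner ℂ (opTensor A B x) y = inner ℂ x (opTensor A B y)) ?_
    (fun x y => ?_) x y
  · exact isClosed_eq
      (((opTensor A B).continuous.comp continuous_fst).inner continuous_snd)
      (continuous_fst.inner ((opTensor A B).continuous.comp continuous_snd))
  · simp only [opTensor_tensorIncl, LinearIsometry.inner_map_map, hsymm]

/-- A ⊗ B is the square of the self-adjoint operator √A ⊗ √B. -/
theorem isPositive_opTensor {A : H.Op} {B : K.Op} (hA : A.IsPositive) (hB : B.IsPositive) :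
    (opTensor A B).IsPositive := by
  rw [← ContinuousLinearMap.nonneg_iff_isPositive] at *
  rw [← CFC.sqrt_mul_sqrt_self A, ← CFC.sqrt_mul_sqrt_self B, opTensor_mul]
  exact (isSelfAdjoint_opTensor (.of_nonneg (CFC.sqrt_nonneg A))
    (.of_nonneg (CFC.sqrt_nonneg B))).mul_self_nonneg

end HilbertSp

/-! ### Products of N operators and the expansion of the Bell operator. -/

theorem tensorOp_succ (N : ℕ) (H : Fin (N + 1 + 1) → HilbertSp.{u})
    (A : (n : Fin (N + 1 + 1)) → (H n).Op) :
    tensorOp (N + 1 + 1) H A = HilbertSp.opTensor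
      (tensorOp (N + 1) (fun i => H i.castSucc) (fun i => A i.castSucc))
        (A (Fin.last (N + 1))) := rfl

theorem tensorOp_one (N : ℕ) (H : Fin (N + 1) → HilbertSp.{u}) :
    tensorOp (N + 1) H (fun _ => 1) = 1 := by
  induction N with
  | zero => rfl
  | succ N ih => rw [tensorOp_succ, ih]; exact HilbertSp.opTensor_one_one

theorem isPositive_tensorOp (N : ℕ) (H : Fin (N + 1) → HilbertSp.{u})
    (A : (n : Fin (N + 1)) → (H n).Op)
    (hA : ∀ n, (A n).IsPositive) : (tensorOp (N + 1) H A).IsPositive := by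
  induction N with
  | zero => exact hA 0
  | succ N ih => exact HilbertSp.isPositive_opTensor (ih _ _ fun i => hA _) (hA _)

theorem norm_tensorOp_le (N : ℕ) (H : Fin (N + 1) → HilbertSp.{u})
    (A : (n : Fin (N + 1)) → (H n).Op) :
    ‖tensorOp (N + 1) H A‖ ≤ ∏ n, ‖A n‖ := by
  induction N with
  | zero =>
    rw [Fin.prod_univ_one]
    exact le_rfl
  | succ N ih =>
    rw [Fin.prod_univ_castSucc, tensorOp_succ]
    exact (HilbertSp.norm_opTensor_le _ _).trans (by gcongr; exact ih _ _)

theorem tensorOp_update_add (N : ℕ) (H : Fin (N + 1) → HilbertSp.{u})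
    (A : (n : Fin (N + 1)) → (H n).Op) (i : Fin (N + 1)) (x y : (H i).Op) :
    tensorOp (N + 1) H (Function.update A i (x + y)) =
      tensorOp (N + 1) H (Function.update A i x) + tensorOp (N + 1) H (Function.update A i y) := by
  induction N with
  | zero =>
    obtain rfl : i = 0 := Fin.fin_one_eq_zero i
    change Function.update A 0 _ 0 = _
    rw [Function.update_self]
    exact congrArg₂ _ (Function.update_self 0 x A).symm (Function.update_self 0 y A).symm
  | succ N ih =>
    simp only [tensorOp_succ]
    obtain ⟨i, rfl⟩ | rfl := i.eq_castSucc_or_eq_last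
    · have h : ∀ z : (H (Fin.castSucc i)).Op,
          (fun j : Fin (N + 1) => Function.update A i.castSucc z j.castSucc) =
            Function.update (fun j => A j.castSucc) i z := fun z => by
        ext1 j
        rcases eq_or_ne j i with rfl | hj
        · simp
        · rw [Function.update_of_ne hj, Function.update_of_ne (by simpa using hj)]
      simp only [h, Function.update_of_ne (Fin.castSucc_lt_last i).ne', ih (fun i => H i.castSucc)]
      exact HilbertSp.opTensor_add_left _ _ _
    · have h : ∀ z : (H (Fin.last (N + 1))).Op,
          (fun i : Fin (N + 1) => Function.update A (Fin.last (N + 1)) z i.castSucc) =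
            fun i : Fin (N + 1) => A i.castSucc := fun z => by
        ext1 j; exact Function.update_of_ne (Fin.castSucc_lt_last j).ne _ _
      simp only [h, Function.update_self]
      exact HilbertSp.opTensor_add_right _ _ _

theorem tensorOp_update_smul (N : ℕ) (H : Fin (N + 1) → HilbertSp.{u})
    (A : (n : Fin (N + 1)) → (H n).Op) (i : Fin (N + 1)) (c : ℂ) (x : (H i).Op) :
    tensorOp (N + 1) H (Function.update A i (c • x)) =
      c • tensorOp (N + 1) H (Function.update A i x) := by
  induction N with
  | zero =>
    obtain rfl : i = 0 := Fin.fin_one_eq_zero i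
    change Function.update A 0 _ 0 = _
    rw [Function.update_self]
    exact congrArg _ (Function.update_self 0 x A).symm
  | succ N ih =>
    simp only [tensorOp_succ]
    obtain ⟨i, rfl⟩ | rfl := i.eq_castSucc_or_eq_last
    · have h : ∀ z : (H (Fin.castSucc i)).Op,
          (fun j : Fin (N + 1) => Function.update A i.castSucc z j.castSucc) =
            Function.update (fun j => A j.castSucc) i z := fun z => by
        ext1 j
        rcases eq_or_ne j i with rfl | hj
        · simp
        · rw [Function.update_of_ne hj, Function.update_of_ne (by simpa using hj)]
      simp only [h, Function.update_of_ne (Fin.castSucc_lt_last i).ne', ih (fun i => H i.castSucc)]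
      exact HilbertSp.opTensor_smul_left _ _ _
    · have h : ∀ z : (H (Fin.last (N + 1))).Op,
          (fun i : Fin (N + 1) => Function.update A (Fin.last (N + 1)) z i.castSucc) =
            fun i : Fin (N + 1) => A i.castSucc := fun z => by
        ext1 j; exact Function.update_of_ne (Fin.castSucc_lt_last j).ne _ _
      simp only [h, Function.update_self]
      exact HilbertSp.opTensor_smul_right _ _ _

/-- `A ↦ A₁ ⊗ ⋯ ⊗ A_N` as a continuous multilinear map. -/
noncomputable def tensorOpMultilinear (N : ℕ) (H : Fin (N + 1) → HilbertSp.{u}) :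
    ContinuousMultilinearMap ℂ (fun n => (H n).Op) (tensorSpace (N + 1) H).Op :=
  MultilinearMap.mkContinuous
    { toFun := tensorOp (N + 1) H
      -- The field ranges over every decidable equality on the index type, whereas the lemma uses
      -- the standard one.
      map_update_add' := fun {inst} A i x y => by
        rw [Subsingleton.elim inst (instDecidableEqFin _)]; exact tensorOp_update_add N H A i x y
      map_update_smul' := fun {inst} A i c x => by
        rw [Subsingleton.elim inst (instDecidableEqFin _)]
        exact tensorOp_update_smul N H A i c x } 1
    fun A => by rw [one_mul]; exact norm_tensorOp_le N H A

theorem tensorOpMultilinear_apply (N : ℕ) (H : Fin (N + 1) → HilbertSp.{u})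
    (A : (n : Fin (N + 1)) → (H n).Op) : tensorOpMultilinear N H A = tensorOp (N + 1) H A := rfl

theorem tensorOp_sum (N : ℕ) (H : Fin (N + 1) → HilbertSp.{u}) {ι : Fin (N + 1) → Type*}
    [∀ n, Fintype (ι n)] (c : (n : Fin (N + 1)) → ι n → ℂ) (A : (n : Fin (N + 1)) → ι n → (H n).Op) :
    tensorOp (N + 1) H (fun n => ∑ j, c n j • A n j) =
      ∑ r : (n : Fin (N + 1)) → ι n, (∏ n, c n (r n)) • tensorOp (N + 1) H (fun n => A n (r n)) := by
  simp only [← tensorOpMultilinear_apply]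
  rw [ContinuousMultilinearMap.map_sum]
  simp only [ContinuousMultilinearMap.map_smul_univ]

/-- Heterogeneous equality lets the recursion be used with the N-fold space kept opaque, identified
with a binary tensor product by a separate equation. -/
theorem bellOp_succ (N : ℕ) (H : Fin (N + 1 + 1) → HilbertSp.{u})
    (X : (n : Fin (N + 1 + 1)) → Fin 2 → (H n).Op) :
    HEq (bellOp (N + 1 + 1) H X) ((HilbertSp.opTensor
        (bellOp (N + 1) (fun i => H i.castSucc) (fun i s => X i.castSucc s))
        (X (Fin.last (N + 1)) 0 + X (Fin.last (N + 1)) 1) +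
      HilbertSp.opTensor
        (bellOp (N + 1) (fun i => H i.castSucc) (fun i s => X i.castSucc s.rev))
        (X (Fin.last (N + 1)) 0 - X (Fin.last (N + 1)) 1)) :
        ((tensorSpace (N + 1) fun i => H i.castSucc).tensor (H (Fin.last (N + 1)))).Op) := HEq.rfl

/-- The recursion step of the expansion of the Bell operator; `Y` is the tensor product space. -/
theorem HilbertSp.eq_sum_smul_of_tensor {Y H K : HilbertSp.{u}} (e : Y = H.tensor K) {n : ℕ}
    (T : (Fin n → Fin 2) → H.Op) (B : Fin 2 → K.Op) {g g' : (Fin n → Fin 2) → ℂ}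
    {γ : (Fin (n + 1) → Fin 2) → ℂ} (h0 : ∀ t, γ (Fin.snoc t 0) = g t + g' t)
    (h1 : ∀ t, γ (Fin.snoc t 1) = g t - g' t) {S S' : H.Op} (hS : S = ∑ t, g t • T t)
    (hS' : S' = ∑ t, g' t • T t) {L : Y.Op}
    (hL : HEq L (opTensor S (B 0 + B 1) + opTensor S' (B 0 - B 1)))
    {F : (Fin (n + 1) → Fin 2) → Y.Op}
    (hF : ∀ t i, HEq (F (Fin.snoc t i)) (opTensor (T t) (B i))) : L = ∑ s, γ s • F s := by
  subst e
  rw [eq_of_heq hL, hS, hS', opTensor_sum_smul_left, opTensor_sum_smul_left, sum_settings_succ,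
    ← Finset.sum_add_distrib]
  refine Finset.sum_congr rfl fun t _ => ?_
  rw [h0, h1, eq_of_heq (hF t 0), eq_of_heq (hF t 1)]
  exact smul_opTensor_add_add_smul_opTensor_sub _ _ _ _ _

theorem bellOp_eq_sum (n : ℕ) (H : Fin (n + 1 + 1) → HilbertSp.{u})
    (X : (n : Fin (n + 1 + 1)) → Fin 2 → (H n).Op) :
    bellOp (n + 1 + 1) H X =
      ∑ s, (mkCoeff (n + 1 + 1) s : ℂ) • tensorOp (n + 1 + 1) H (fun i => X i (s i)) := by
  induction n with
  | zero =>
    -- The coefficients start at two sites, so the CHSH operator is expanded by hand.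
    rw [sum_settings_succ, sum_settings_succ]
    have h : HilbertSp.opTensor (X 0 0) (X 1 0 + X 1 1) +
        HilbertSp.opTensor (X 0 1) (X 1 0 - X 1 1) =
        HilbertSp.opTensor (X 0 0) (X 1 0) + HilbertSp.opTensor (X 0 0) (X 1 1) +
          (HilbertSp.opTensor (X 0 1) (X 1 0) + -HilbertSp.opTensor (X 0 1) (X 1 1)) := by
      rw [HilbertSp.opTensor_add_right, HilbertSp.opTensor_sub_right, sub_eq_add_neg]
    simp only [mkCoeff, Fin.snoc, Finset.univ_unique, Finset.sum_singleton]
    simp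
    exact h
  | succ n ih =>
    refine HilbertSp.eq_sum_smul_of_tensor (Y := tensorSpace (n + 1 + 1 + 1) H)
      (H := tensorSpace (n + 1 + 1) fun i => H i.castSucc) (K := H (Fin.last (n + 1 + 1)))
      (g := fun t => mkCoeff (n + 1 + 1) t)
      (g' := fun t => mkCoeff (n + 1 + 1) fun i => (t i).rev) rfl
      (fun t => tensorOp (n + 1 + 1) (fun i => H i.castSucc) fun i => X i.castSucc (t i))
      (X (Fin.last (n + 1 + 1)))
      (fun t => by rw [mkCoeff_snoc_zero, Complex.ofReal_add])
      (fun t => by rw [mkCoeff_snoc_one, Complex.ofReal_sub])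
      (S' := bellOp (n + 1 + 1) (fun i => H i.castSucc) fun i s => X i.castSucc s.rev)
      (ih _ _) ?_ ?_ fun t j => ?_
    -- Reindexing the sum by the flip moves the interchange from the observables to the
    -- coefficients.
    · rw [ih, ← sum_settings_rev]
      simp only [Fin.rev_rev]
    · exact bellOp_succ (n + 1) H X
    · rw [tensorOp_succ (n + 1)]
      simp only [Fin.snoc_castSucc, Fin.snoc_last]
      rfl

/-! ### Positive operator-valued measures -/

/-- A real quadratic form forces symmetry, and the norm of a symmetric operator is the supremum of
|Rayleigh quotient|. -/
theorem HilbertSp.norm_le_of_inner_self {H : HilbertSp.{u}} {T : H.Op} {c : ℝ}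
    (h : ∀ ψ : H, ∃ r : ℝ, inner ℂ ψ (T ψ) = r ∧ |r| ≤ c * ‖ψ‖ ^ 2) (hc : 0 ≤ c) : ‖T‖ ≤ c := by
  choose r hr hrc using h
  have hr' : ∀ ψ, inner ℂ (T ψ) ψ = r ψ := fun ψ => by
    rw [← inner_conj_symm, hr, Complex.conj_ofReal]
  have hT : (T : H →ₗ[ℂ] H).IsSymmetric := by
    rw [LinearMap.isSymmetric_iff_inner_map_self_real]
    intro ψ
    rw [ContinuousLinearMap.coe_coe, hr', Complex.conj_ofReal]
  rw [ContinuousLinearMap.norm_eq_iSup_rayleighQuotient T hT]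
  refine ciSup_le fun ψ => ?_
  rw [ContinuousLinearMap.rayleighQuotient, ContinuousLinearMap.reApplyInnerSelf_apply, hr',
    abs_div, abs_of_nonneg (sq_nonneg ‖ψ‖)]
  exact div_le_of_le_mul₀ (sq_nonneg _) hc (hrc ψ)

namespace POVM

variable {Λ : Type*} [MeasurableSpace Λ] {H : HilbertSp.{u}}

theorem inner_toFun (M : POVM Λ H) (ψ : H) {A : Set Λ} (hA : MeasurableSet A) :
    inner ℂ ψ (M.toFun A ψ) = ((M.measure ψ).real A : ℂ) := by
  have h : 0 ≤ (inner ℂ ψ (M.toFun A ψ)).re := (M.isPositive A hA).re_inner_nonneg_right ψ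
  rw [measureReal_def, M.measure_apply ψ hA, ENNReal.toReal_ofReal h]
  exact Complex.ext rfl ((M.isPositive A hA).isSymmetric.im_inner_self_apply ψ)

theorem measure_univ (M : POVM Λ H) (ψ : H) :
    M.measure ψ Set.univ = ENNReal.ofReal (‖ψ‖ ^ 2) := by
  rw [M.measure_apply ψ .univ, M.map_univ]
  exact congrArg _ (inner_self_eq_norm_sq (𝕜 := ℂ) ψ)

instance isFiniteMeasure_measure (M : POVM Λ H) (ψ : H) : IsFiniteMeasure (M.measure ψ) :=
  ⟨by rw [M.measure_univ]; exact ENNReal.ofReal_lt_top⟩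

theorem measureReal_univ (M : POVM Λ H) (ψ : H) : (M.measure ψ).real Set.univ = ‖ψ‖ ^ 2 := by
  rw [measureReal_def, M.measure_univ, ENNReal.toReal_ofReal (sq_nonneg _)]

end POVM

/-! ### Discretization of real outcomes -/

/-- The cells of the partition of `Λ` by the value of `⌊(m + 1) x⌋`. -/
def floorCell (Λ : Set ℝ) (m : ℕ) (k : ℤ) : Set Λ := {x | ⌊((m : ℝ) + 1) * x⌋ = k}

theorem measurableSet_floorCell (Λ : Set ℝ) (m : ℕ) (k : ℤ) : MeasurableSet (floorCell Λ m k) :=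
  (Int.measurable_floor.comp (measurable_subtype_coe.const_mul _)) (measurableSet_singleton k)

/-- The step function approximating the identity, constant on the cells. -/
noncomputable def floorStep (m : ℕ) (x : ℝ) : ℝ := ⌊((m : ℝ) + 1) * x⌋ / ((m : ℝ) + 1)

theorem measurable_floorStep (m : ℕ) : Measurable (floorStep m) := by
  unfold floorStep
  exact (measurable_from_top.comp (Int.measurable_floor.comp (measurable_const_mul _))).div_const _

theorem abs_sub_floorStep_le (m : ℕ) (x : ℝ) : |x - floorStep m x| ≤ 1 / ((m : ℝ) + 1) := by
  have hm : (0 : ℝ) < (m : ℝ) + 1 := by positivity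
  have h : x - floorStep m x = Int.fract (((m : ℝ) + 1) * x) / ((m : ℝ) + 1) := by
    rw [floorStep, Int.fract]
    field_simp
  rw [h, abs_of_nonneg (div_nonneg (Int.fract_nonneg _) hm.le)]
  gcongr
  exact (Int.fract_lt_one _).le

/-- The labels of the cells that meet `[-1, 1]`. -/
abbrev FloorIndex (m : ℕ) : Type := Finset.Icc (-(m + 1 : ℤ)) (m + 1)

open Classical in
theorem floorStep_eq_sum {Λ : Set ℝ} (hΛ : Λ ⊆ Set.Icc (-1) 1) (m : ℕ) (x : Λ) :
    floorStep m x = ∑ k : FloorIndex m, (k : ℝ) / ((m : ℝ) + 1) *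
      (if x ∈ floorCell Λ m k then 1 else 0) := by
  have hm : (0 : ℝ) < (m : ℝ) + 1 := by positivity
  have hx := hΛ x.2
  -- For outcomes in [-1, 1] finitely many labels suffice, and exactly one cell contains x.
  have hk : ⌊((m : ℝ) + 1) * x⌋ ∈ Finset.Icc (-(m + 1 : ℤ)) (m + 1) := by
    rw [Finset.mem_Icc, Int.le_floor]
    constructor
    · push_cast; nlinarith [hx.1]
    · rw [← Int.cast_le (R := ℝ)]
      refine (Int.floor_le _).trans ?_
      push_cast; nlinarith [hx.2]
  rw [Finset.sum_eq_single ⟨_, hk⟩]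
  · simp [floorCell, floorStep]
  · intro k _ hne
    have : x ∉ floorCell Λ m k := fun h => hne (Subtype.ext h.symm)
    simp [this]
  · simp

/-- A crude bound, 1 for x plus at most 1 for rounding; it serves only for integrability and
domination. -/
theorem abs_floorStep_le (m : ℕ) {x : ℝ} (hx : x ∈ Set.Icc (-1 : ℝ) 1) : |floorStep m x| ≤ 2 := by
  have h1 := abs_sub_floorStep_le m x
  have h2 : 1 / ((m : ℝ) + 1) ≤ 1 := by
    rw [div_le_one (by positivity)]; linarith [(Nat.cast_nonneg m : (0 : ℝ) ≤ m)]
  have h3 := abs_le.mpr hx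
  have h4 := abs_sub_abs_le_abs_sub (floorStep m x) x
  rw [abs_sub_comm] at h4
  linarith

theorem tendsto_floorStep (x : ℝ) :
    Filter.Tendsto (fun m => floorStep m x) Filter.atTop (nhds x) := by
  rw [tendsto_iff_dist_tendsto_zero]
  refine squeeze_zero (fun _ => dist_nonneg) (fun m => ?_)
    (tendsto_one_div_add_atTop_nhds_zero_nat (𝕜 := ℝ))
  rw [dist_comm]
  exact abs_sub_floorStep_le m x

/-- The discretized observable of a measurement with real outcomes. -/
noncomputable def POVM.floorMean {Λ : Set ℝ} {H : HilbertSp.{u}} (M : POVM Λ H) (m : ℕ) : H.Op :=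
  ∑ k : FloorIndex m, (((k : ℝ) / ((m : ℝ) + 1) : ℝ) : ℂ) • M.toFun (floorCell Λ m k)

theorem POVM.inner_floorMean {Λ : Set ℝ} (hΛ : Λ ⊆ Set.Icc (-1) 1) {H : HilbertSp.{u}}
    (M : POVM Λ H) (m : ℕ) (ψ : H) :
    inner ℂ ψ (M.floorMean m ψ) = ((∫ x, floorStep m x ∂(M.measure ψ) : ℝ) : ℂ) := by
  classical
  have h : ∫ x, floorStep m x ∂(M.measure ψ) =
      ∑ k : FloorIndex m, (k : ℝ) / ((m : ℝ) + 1) * (M.measure ψ).real (floorCell Λ m k) := by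
    simp only [floorStep_eq_sum hΛ]
    have hi : ∀ k : ℤ, (fun x : Λ => if x ∈ floorCell Λ m k then (1 : ℝ) else 0) =
      (floorCell Λ m k).indicator 1 := fun k => by ext x; simp [Set.indicator_apply]
    rw [integral_finsetSum]
    · refine Finset.sum_congr rfl fun k _ => ?_
      rw [integral_const_mul, hi, integral_indicator_one (measurableSet_floorCell Λ m k)]
    · intro k _
      refine Integrable.const_mul ?_ _
      rw [hi]
      exact (integrable_const (1 : ℝ)).indicator (measurableSet_floorCell Λ m k)
  rw [h, POVM.floorMean]
  simp only [FunLike.coe_sum, Finset.sum_apply, FunLike.coe_smul, Pi.smul_apply, inner_sum,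
    inner_smul_right, M.inner_toFun ψ (measurableSet_floorCell Λ m _)]
  push_cast
  rfl

/-- The quadratic form of the difference integrates the rounding error against a measure of mass
‖ψ‖². -/
theorem POVM.norm_sub_floorMean_le {Λ : Set ℝ} (hΛ : Λ ⊆ Set.Icc (-1) 1) {H : HilbertSp.{u}}
    {M : POVM Λ H} {X : H.Op} (hX : M.IsMean X) (m : ℕ) :
    ‖X - M.floorMean m‖ ≤ 1 / ((m : ℝ) + 1) := by
  refine HilbertSp.norm_le_of_inner_self (fun ψ => ⟨∫ x : Λ, ((x : ℝ) - floorStep m x) ∂(M.measure ψ),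
    ?_, ?_⟩) (by positivity)
  · rw [integral_sub, Complex.ofReal_sub, ← M.inner_floorMean hΛ, ← hX ψ, ← inner_sub_right]
    · rfl
    · exact Integrable.of_bound measurable_subtype_coe.aestronglyMeasurable 1
        (Filter.Eventually.of_forall fun x => abs_le.mpr (hΛ x.2))
    · exact Integrable.of_bound
        ((measurable_floorStep m).comp measurable_subtype_coe).aestronglyMeasurable 2
        (Filter.Eventually.of_forall fun x => abs_floorStep_le m (hΛ x.2))
  · have := norm_integral_le_of_norm_le_const (μ := M.measure ψ)
      (f := fun x : Λ => (x : ℝ) - floorStep m x)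
      (Filter.Eventually.of_forall fun x => abs_sub_floorStep_le m x)
    rwa [M.measureReal_univ] at this

theorem POVM.tendsto_floorMean {Λ : Set ℝ} (hΛ : Λ ⊆ Set.Icc (-1) 1) {H : HilbertSp.{u}}
    {M : POVM Λ H} {X : H.Op} (hX : M.IsMean X) :
    Filter.Tendsto M.floorMean Filter.atTop (nhds X) := by
  rw [tendsto_iff_norm_sub_tendsto_zero]
  refine squeeze_zero (fun _ => norm_nonneg _) (fun m => ?_)
    (tendsto_one_div_add_atTop_nhds_zero_nat (𝕜 := ℝ))
  rw [norm_sub_rev]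
  exact POVM.norm_sub_floorMean_le hΛ hX m

/-- For a joint distribution given by product operators, the expectation of the product of the
discretized outcomes. -/
theorem functional_tensorOp_floorMean {N : ℕ} {H : Fin (N + 1) → HilbertSp.{u}}
    (φ : (tensorSpace (N + 1) H).Op →L[ℂ] ℂ) {Λ : Fin (N + 1) → Set ℝ}
    (hΛ : ∀ n, Λ n ⊆ Set.Icc (-1) 1) (M : (n : Fin (N + 1)) → POVM (Λ n) (H n))
    (P : Measure ((n : Fin (N + 1)) → Λ n)) [IsFiniteMeasure P]
    (hP : ∀ A : (n : Fin (N + 1)) → Set (Λ n), (∀ n, MeasurableSet (A n)) →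
      φ (tensorOp (N + 1) H fun n => (M n).toFun (A n)) = (P.real (Set.univ.pi A) : ℂ)) (m : ℕ) :
    φ (tensorOp (N + 1) H fun n => (M n).floorMean m) =
      ((∫ x, ∏ n, floorStep m (x n) ∂P : ℝ) : ℂ) := by
  classical
  simp only [POVM.floorMean]
  rw [tensorOp_sum N H (fun _ (k : FloorIndex m) => (((k : ℝ) / ((m : ℝ) + 1) : ℝ) : ℂ))
    fun n k => (M n).toFun (floorCell (Λ n) m k)]
  simp only [map_sum, map_smul]
  have hA : ∀ r : Fin (N + 1) → FloorIndex m,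
      MeasurableSet (Set.univ.pi fun n => floorCell (Λ n) m (r n)) := fun r =>
    MeasurableSet.univ_pi fun n => measurableSet_floorCell _ _ _
  -- A product of cell indicators is the indicator of a box, where the joint distribution is known.
  have hi : ∀ (r : Fin (N + 1) → FloorIndex m) (x : (n : Fin (N + 1)) → Λ n),
      ∏ n, ((r n : ℝ) / ((m : ℝ) + 1) * (if x n ∈ floorCell (Λ n) m (r n) then 1 else 0)) =
        (∏ n, (r n : ℝ) / ((m : ℝ) + 1)) *
          (Set.univ.pi fun n => floorCell (Λ n) m (r n)).indicator 1 x := fun r x => by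
    rw [Finset.prod_mul_distrib, Fintype.prod_boole, Set.indicator_apply]
    simp [Set.mem_pi]
  have h : ∫ x, ∏ n, floorStep m (x n) ∂P = ∑ r : Fin (N + 1) → FloorIndex m,
      (∏ n, (r n : ℝ) / ((m : ℝ) + 1)) *
        P.real (Set.univ.pi fun n => floorCell (Λ n) m (r n)) := by
    simp only [floorStep_eq_sum (hΛ _), Finset.prod_univ_sum, Fintype.piFinset_univ, hi]
    rw [integral_finsetSum]
    · exact Finset.sum_congr rfl fun r _ => by
        rw [integral_const_mul, integral_indicator_one (hA r)]
    · exact fun r _ => ((integrable_const (1 : ℝ)).indicator (hA r)).const_mul _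
  rw [h, Complex.ofReal_sum]
  refine Finset.sum_congr rfl fun r _ => ?_
  rw [hP _ fun n => measurableSet_floorCell _ _ _, smul_eq_mul, Complex.ofReal_mul,
    Complex.ofReal_prod]

/-- The expectation of the product of the outcomes is the expectation of the product observable. -/
theorem functional_tensorOp_mean {N : ℕ} {H : Fin (N + 1) → HilbertSp.{u}}
    (φ : (tensorSpace (N + 1) H).Op →L[ℂ] ℂ) {Λ : Fin (N + 1) → Set ℝ}
    (hΛ : ∀ n, Λ n ⊆ Set.Icc (-1) 1) (M : (n : Fin (N + 1)) → POVM (Λ n) (H n))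
    (P : Measure ((n : Fin (N + 1)) → Λ n)) [IsFiniteMeasure P]
    (hP : ∀ A : (n : Fin (N + 1)) → Set (Λ n), (∀ n, MeasurableSet (A n)) →
      φ (tensorOp (N + 1) H fun n => (M n).toFun (A n)) = (P.real (Set.univ.pi A) : ℂ))
    (X : (n : Fin (N + 1)) → (H n).Op) (hX : ∀ n, (M n).IsMean (X n)) :
    φ (tensorOp (N + 1) H X) = ((∫ x, ∏ n, (x n : ℝ) ∂P : ℝ) : ℂ) := by
  -- The discretized means converge in norm, and `tensorOp` is jointly norm continuous.
  have h1 : Filter.Tendsto (fun m => φ (tensorOp (N + 1) H fun n => (M n).floorMean m))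
      Filter.atTop (nhds (φ (tensorOp (N + 1) H X))) :=
    ((φ.continuous.comp (tensorOpMultilinear N H).cont).tendsto X).comp
      (tendsto_pi_nhds.mpr fun n => POVM.tendsto_floorMean (hΛ n) (hX n))
  have h2 : Filter.Tendsto (fun m => ∫ x : (n : Fin (N + 1)) → Λ n, ∏ n, floorStep m (x n) ∂P)
      Filter.atTop (nhds (∫ x, ∏ n, (x n : ℝ) ∂P)) := by
    refine tendsto_integral_of_dominated_convergence (fun _ => 2 ^ (N + 1)) (fun m => ?_)
      (integrable_const _) (fun m => Filter.Eventually.of_forall fun x => ?_)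
      (Filter.Eventually.of_forall fun x =>
        tendsto_finsetProd _ fun n _ => tendsto_floorStep (x n))
    · exact (Finset.measurable_prod _ fun n _ => (measurable_floorStep m).comp
        (measurable_subtype_coe.comp (measurable_pi_apply n))).aestronglyMeasurable
    · rw [norm_prod]
      refine (Finset.prod_le_prod (fun _ _ => norm_nonneg _)
        fun n _ => abs_floorStep_le m (hΛ n (x n).2)).trans_eq ?_
      simp
  refine tendsto_nhds_unique h1 ?_
  simp only [functional_tensorOp_floorMean φ hΛ M P hP]
  exact (Complex.continuous_ofReal.tendsto _).comp h2

/-- The Bell inequality for an experiment on a state that admits a local hidden variable model. -/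
theorem exists_hasTrace_bellOp_of_admitsLHV (n : ℕ) (H : Fin (n + 1 + 1) → HilbertSp.{u})
    (ρ : (tensorSpace (n + 1 + 1) H).Op) (hρ : IsState ρ)
    (Λ : Fin (n + 1 + 1) → Fin 2 → Set ℝ) (hΛ : ∀ n s, Λ n s ⊆ Set.Icc (-1) 1)
    (M : (n : Fin (n + 1 + 1)) → (s : Fin 2) → POVM (Λ n s) (H n))
    (P : (s : Fin (n + 1 + 1) → Fin 2) → Measure ((n : Fin (n + 1 + 1)) → Λ n (s n)))
    (hP : ∀ s, IsProbabilityMeasure (P s)) (hE : IsQuantumExperiment ρ (fun n s => Λ n s) M P)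
    (hL : AdmitsLHV.{w} (fun n s => Λ n s) P)
    (X : (n : Fin (n + 1 + 1)) → Fin 2 → (H n).Op) (hX : ∀ n s, (M n s).IsMean (X n s)) :
    ∃ z : ℂ, HasTrace (ρ ∘L bellOp (n + 1 + 1) H X) z ∧ ‖z‖ ≤ 2 ^ (n + 1) := by
  obtain ⟨φ, hφ, -⟩ := hρ.exists_functional
  refine ⟨_, hφ _, ?_⟩
  have hc : ∀ s : Fin (n + 1 + 1) → Fin 2,
      φ (tensorOp (n + 1 + 1) H fun i => X i (s i)) = (corr Λ P s : ℂ) := fun s =>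
    functional_tensorOp_mean φ (fun i => hΛ i (s i)) (fun i => M i (s i)) (P s)
      (fun A hA => (hφ _).unique (hE s A hA)) _ fun i => hX i (s i)
  rw [bellOp_eq_sum]
  simp only [map_sum, map_smul, hc, smul_eq_mul, ← Complex.ofReal_mul, ← Complex.ofReal_sum,
    Complex.norm_real]
  exact abs_sum_mkCoeff_mul_corr_le n Λ hΛ P hP hL

/-! ### Measurements with finitely many outcomes -/

open Classical in
theorem hasSum_ite_mem_iUnion {Λ E : Type*} [AddCommGroup E] [TopologicalSpace E] (A : ℕ → Set Λ)
    (hA : Pairwise fun i j => Disjoint (A i) (A j)) (p : Λ) (x : E) :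
    HasSum (fun k => if p ∈ A k then x else 0) (if p ∈ ⋃ k, A k then x else 0) := by
  by_cases h : p ∈ ⋃ k, A k
  · obtain ⟨k, hk⟩ := Set.mem_iUnion.mp h
    rw [if_pos h]
    convert hasSum_single k fun j hj => ?_
    · rw [if_pos hk]
    · exact if_neg fun hj' => Set.disjoint_left.mp (hA hj) hj' hk
  · rw [if_neg h]
    convert hasSum_zero with k
    exact if_neg fun hk => h (Set.mem_iUnion.mpr ⟨k, hk⟩)

open Classical in
/-- The measurement with outcomes `o j` and effects `E j`. -/
noncomputable def POVM.ofEffects {Λ : Type*} [MeasurableSpace Λ] {H : HilbertSp.{u}} {ι : Type*}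
    [Fintype ι] (o : ι → Λ) (E : ι → H.Op) (hE : ∀ j, (E j).IsPositive) (h1 : ∑ j, E j = 1) :
    POVM Λ H where
  toFun A := ∑ j, (if o j ∈ A then (1 : ℂ) else 0) • E j
  isPositive A _ := by
    refine ContinuousLinearMap.isPositive_sum _ fun j _ => ?_
    split_ifs
    · simpa using hE j
    · simp
  map_univ := by simpa using h1
  hasSum_iUnion A _ hd ψ := by
    simp only [FunLike.coe_sum, Finset.sum_apply, FunLike.coe_smul, Pi.smul_apply]
    refine hasSum_sum fun j _ => ?_
    simpa only [ite_smul, one_smul, zero_smul] using hasSum_ite_mem_iUnion A hd (o j) (E j ψ)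

theorem POVM.measure_ofEffects {Λ : Type*} [MeasurableSpace Λ] {H : HilbertSp.{u}} {ι : Type*}
    [Fintype ι] (o : ι → Λ) (E : ι → H.Op) (hE : ∀ j, (E j).IsPositive) (h1 : ∑ j, E j = 1)
    (ψ : H) : (POVM.ofEffects o E hE h1).measure ψ =
      ∑ j, ENNReal.ofReal (inner ℂ ψ (E j ψ)).re • Measure.dirac (o j) := by
  classical
  ext A hA
  rw [POVM.measure_apply _ _ hA, Measure.finsetSum_apply]
  simp only [POVM.ofEffects, FunLike.coe_sum, Finset.sum_apply, FunLike.coe_smul, Pi.smul_apply,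
    inner_sum, Complex.re_sum, Measure.smul_apply, Measure.dirac_apply' _ hA, smul_eq_mul]
  rw [ENNReal.ofReal_sum_of_nonneg]
  · refine Finset.sum_congr rfl fun j _ => ?_
    by_cases h : o j ∈ A <;> simp [h]
  · intro j _
    by_cases h : o j ∈ A
    · simpa [h] using (hE j).re_inner_nonneg_right ψ
    · simp [h]

theorem POVM.isMean_ofEffects {Λ : Set ℝ} {H : HilbertSp.{u}} {ι : Type*} [Fintype ι] (o : ι → Λ)
    (E : ι → H.Op) (hE : ∀ j, (E j).IsPositive) (h1 : ∑ j, E j = 1) :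
    (POVM.ofEffects o E hE h1).IsMean (∑ j, ((o j : ℝ) : ℂ) • E j) := by
  intro ψ
  rw [POVM.measure_ofEffects, integral_finsetSum_measure]
  · simp only [integral_smul_measure, integral_dirac, FunLike.coe_sum, Finset.sum_apply,
      FunLike.coe_smul, Pi.smul_apply, inner_sum, inner_smul_right, Complex.ofReal_sum, smul_eq_mul,
      Complex.ofReal_mul]
    refine Finset.sum_congr rfl fun j _ => ?_
    have h : 0 ≤ (inner ℂ ψ (E j ψ)).re := (hE j).re_inner_nonneg_right ψ
    rw [ENNReal.toReal_ofReal h, mul_comm]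
    congr 1
    exact Complex.ext rfl ((hE j).isSymmetric.im_inner_self_apply ψ)
  · intro j _
    exact (integrable_dirac (by simp)).smul_measure ENNReal.ofReal_ne_top

/-- Measurements with finitely many outcomes on a state have a joint distribution. -/
theorem exists_joint_distribution_ofEffects {N : ℕ} {H : Fin (N + 1) → HilbertSp.{u}}
    (φ : (tensorSpace (N + 1) H).Op →L[ℂ] ℂ)
    (hφ : ∀ T, T.IsPositive → 0 ≤ (φ T).re ∧ (φ T).im = 0) (hφ1 : φ 1 = 1)
    {Λ : Fin (N + 1) → Type*} [∀ n, MeasurableSpace (Λ n)] {ι : Fin (N + 1) → Type*}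
    [∀ n, Fintype (ι n)] (o : (n : Fin (N + 1)) → ι n → Λ n)
    (E : (n : Fin (N + 1)) → ι n → (H n).Op) (hE : ∀ n j, (E n j).IsPositive)
    (h1 : ∀ n, ∑ j, E n j = 1) :
    ∃ P : Measure ((n : Fin (N + 1)) → Λ n), IsProbabilityMeasure P ∧
      ∀ A : (n : Fin (N + 1)) → Set (Λ n), (∀ n, MeasurableSet (A n)) →
        φ (tensorOp (N + 1) H fun n => (POVM.ofEffects (o n) (E n) (hE n) (h1 n)).toFun (A n)) =
          (P.real (Set.univ.pi A) : ℂ) := by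
  classical
  let p : ((n : Fin (N + 1)) → ι n) → ℝ := fun r => (φ (tensorOp (N + 1) H fun n => E n (r n))).re
  have hpos := fun r : (n : Fin (N + 1)) → ι n =>
    hφ _ (isPositive_tensorOp N H (fun n => E n (r n)) fun n => hE n (r n))
  have hp : ∀ r, φ (tensorOp (N + 1) H fun n => E n (r n)) = (p r : ℂ) := fun r =>
    Complex.ext rfl (hpos r).2
  -- The weights φ(E₁ ⊗ ⋯ ⊗ E_N) are nonnegative because products of positive operators are positive
  -- and φ is positive.
  let P : Measure ((n : Fin (N + 1)) → Λ n) :=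
    ∑ r, ENNReal.ofReal (p r) • Measure.dirac fun n => o n (r n)
  have hP : ∀ A : (n : Fin (N + 1)) → Set (Λ n), (∀ n, MeasurableSet (A n)) →
      φ (tensorOp (N + 1) H fun n => (POVM.ofEffects (o n) (E n) (hE n) (h1 n)).toFun (A n)) =
        (P.real (Set.univ.pi A) : ℂ) := fun A hA => by
    simp only [POVM.ofEffects]
    rw [tensorOp_sum N H (fun n j => if o n j ∈ A n then (1 : ℂ) else 0) E]
    simp only [map_sum, map_smul, hp, smul_eq_mul, Fintype.prod_boole]
    rw [measureReal_def, Measure.finsetSum_apply, ENNReal.toReal_sum, Complex.ofReal_sum]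
    · refine Finset.sum_congr rfl fun r _ => ?_
      rw [Measure.smul_apply, Measure.dirac_apply' _ (MeasurableSet.univ_pi hA), smul_eq_mul,
        ENNReal.toReal_mul, ENNReal.toReal_ofReal (show 0 ≤ p r from (hpos r).1), Set.indicator_apply]
      by_cases h : ∀ n, o n (r n) ∈ A n <;> simp [h, Set.mem_pi]
    · intro r _
      rw [Measure.smul_apply, smul_eq_mul]
      exact ENNReal.mul_ne_top ENNReal.ofReal_ne_top (measure_ne_top _ _)
  refine ⟨P, ⟨?_⟩, hP⟩
  -- Total mass one is the box formula for the full space, where it reads φ(1) = 1.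
  have h := hP (fun _ => Set.univ) fun _ => .univ
  simp only [POVM.map_univ, tensorOp_one, hφ1, Set.pi_univ] at h
  have h' : P.real Set.univ = 1 := by exact_mod_cast h.symm
  rwa [measureReal_def, ENNReal.toReal_eq_one_iff] at h'

/-- By Cauchy–Schwarz, ⟪Xx, x⟫ ≥ -‖x‖² for a contraction. -/
theorem HilbertSp.isPositive_half_one_add {H : HilbertSp.{u}} {X : H.Op} (hX : IsSelfAdjoint X)
    (hX1 : ‖X‖ ≤ 1) : ((1 / 2 : ℂ) • (1 + X)).IsPositive := by
  have h : (1 + X).IsPositive := by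
    refine ContinuousLinearMap.isPositive_def'.mpr ⟨(IsSelfAdjoint.one _).add hX, fun x => ?_⟩
    have h1 : (inner ℂ x x).re = ‖x‖ ^ 2 := inner_self_eq_norm_sq (𝕜 := ℂ) x
    have h2 : ‖inner ℂ (X x) x‖ ≤ ‖x‖ ^ 2 :=
      calc ‖inner ℂ (X x) x‖ ≤ ‖X x‖ * ‖x‖ := norm_inner_le_norm _ _
        _ ≤ (1 * ‖x‖) * ‖x‖ := by gcongr; exact X.le_of_opNorm_le hX1 x
        _ = ‖x‖ ^ 2 := by ring
    have h3 := (abs_le.mp ((Complex.abs_re_le_norm _).trans h2)).1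
    change 0 ≤ (inner ℂ (x + X x) x).re
    rw [inner_add_left, Complex.add_re, h1]
    linarith
  exact h.smul_of_nonneg (by rw [Complex.le_def]; norm_num)

/-- The Bell inequality for arbitrary observables on a state with the local hidden variable
description. -/
theorem exists_hasTrace_bellOp_of_stateAdmitsLHV (n : ℕ) (H : Fin (n + 1 + 1) → HilbertSp.{u})
    (ρ : (tensorSpace (n + 1 + 1) H).Op) (hρ : IsState ρ) (hL : StateAdmitsLHV.{u, w} ρ)
    (X : (n : Fin (n + 1 + 1)) → Fin 2 → (H n).Op) (hX : ∀ n s, IsSelfAdjoint (X n s))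
    (hX1 : ∀ n s, ‖X n s‖ ≤ 1) :
    ∃ z : ℂ, HasTrace (ρ ∘L bellOp (n + 1 + 1) H X) z ∧ ‖z‖ ≤ 2 ^ (n + 1) := by
  obtain ⟨φ, hφ, hφpos⟩ := hρ.exists_functional
  have hφ1 : φ 1 = 1 := (hφ 1).unique hρ.2
  let Λ : Set ℝ := Set.Icc (-1) 1
  let o : Fin 2 → Λ := ![⟨1, by norm_num [Λ]⟩, ⟨-1, by norm_num [Λ]⟩]
  -- The effects (1 ± X)/2 at outcomes ±1 sum to 1 and have mean X; they need not be projections, so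
  -- X need not be dichotomic.
  let E : (i : Fin (n + 1 + 1)) → Fin 2 → Fin 2 → (H i).Op := fun i s =>
    ![(1 / 2 : ℂ) • (1 + X i s), (1 / 2 : ℂ) • (1 - X i s)]
  have hE : ∀ i s j, (E i s j).IsPositive := fun i s j => by
    fin_cases j
    · exact HilbertSp.isPositive_half_one_add (hX i s) (hX1 i s)
    · change ((1 / 2 : ℂ) • (1 - X i s)).IsPositive
      rw [sub_eq_add_neg]
      exact HilbertSp.isPositive_half_one_add (hX i s).neg ((norm_neg _).trans_le (hX1 i s))
  have h1 : ∀ i s, ∑ j, E i s j = 1 := fun i s => by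
    rw [Fin.sum_univ_two]
    simp only [E, Matrix.cons_val_zero, Matrix.cons_val_one]
    module
  have hmean : ∀ i s, ∑ j, ((o j : ℝ) : ℂ) • E i s j = X i s := fun i s => by
    rw [Fin.sum_univ_two]
    simp only [E, o, Matrix.cons_val_zero, Matrix.cons_val_one]
    push_cast
    module
  choose P hP hPE using fun s : Fin (n + 1 + 1) → Fin 2 =>
    exists_joint_distribution_ofEffects φ hφpos hφ1 (fun _ => o) (fun i => E i (s i))
      (fun i => hE i (s i)) (fun i => h1 i (s i))
  have hQ : IsQuantumExperiment ρ (fun _ _ => Λ)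
      (fun i s => POVM.ofEffects o (E i s) (hE i s) (h1 i s)) P := fun s A hA => by
    rw [← hPE s A hA]
    exact hφ _
  refine exists_hasTrace_bellOp_of_admitsLHV.{u, w} n H ρ hρ (fun _ _ => Λ) (fun _ _ => subset_rfl)
    _ P hP hQ (hL (fun _ _ => Λ) _ P hP hQ) X fun i s => ?_
  rw [← hmean i s]
  exact POVM.isMean_ofEffects _ _ _ _

theorem mainTheorem6 (N : ℕ) (hN : 2 ≤ N) :
    -- the maximum over the vertices of the hypercube
    IsGreatest
      ((fun η : Fin N → Fin 2 → ℝ => |linForm (mkCoeff N) η|) ''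
        {η | ∀ n s, η n s = -1 ∨ η n s = 1})
      ((2 : ℝ) ^ (N - 1)) ∧
    -- the inequality for every experiment with outcomes in `[-1, 1]` that admits an LHV model
    (∀ (Λ : Fin N → Fin 2 → Set ℝ) (_ : ∀ n s, Λ n s ⊆ Set.Icc (-1) 1)
      (P : (s : Fin N → Fin 2) → Measure ((n : Fin N) → Λ n (s n)))
      (_ : ∀ s, IsProbabilityMeasure (P s)) (_ : AdmitsLHV.{w} (fun n s => Λ n s) P),
      |∑ s, mkCoeff N s * corr Λ P s| ≤ 2 ^ (N - 1)) ∧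
    -- its tightness whenever the extremal values of the outcomes are `-1` and `1`
    (∀ (Λ : Fin N → Fin 2 → Set ℝ) (_ : ∀ n s, IsGLB (Λ n s) (-1))
      (_ : ∀ n s, IsLUB (Λ n s) 1),
      IsLUB
        {r : ℝ | ∃ P : (s : Fin N → Fin 2) → Measure ((n : Fin N) → Λ n (s n)),
          (∀ s, IsProbabilityMeasure (P s)) ∧ AdmitsLHV.{w} (fun n s => Λ n s) P ∧
            r = |∑ s, mkCoeff N s * corr Λ P s|}
        (2 ^ (N - 1))) ∧
    -- the quantum inequality for an experiment on a state that admits an LHV model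
    (∀ (H : Fin N → HilbertSp.{u}) (ρ : (tensorSpace N H).Op) (_ : IsState ρ)
      (Λ : Fin N → Fin 2 → Set ℝ) (_ : ∀ n s, Λ n s ⊆ Set.Icc (-1) 1)
      (M : (n : Fin N) → (s : Fin 2) → POVM (Λ n s) (H n))
      (P : (s : Fin N → Fin 2) → Measure ((n : Fin N) → Λ n (s n)))
      (_ : ∀ s, IsProbabilityMeasure (P s)) (_ : IsQuantumExperiment ρ (fun n s => Λ n s) M P)
      (_ : AdmitsLHV.{w} (fun n s => Λ n s) P)
      (X : (n : Fin N) → Fin 2 → (H n).Op) (_ : ∀ n s, (M n s).IsMean (X n s)),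
      ∃ z : ℂ, HasTrace (ρ ∘L bellOp N H X) z ∧ ‖z‖ ≤ 2 ^ (N - 1)) ∧
    -- the quantum inequality for arbitrary observables, on a state admitting the LHV description
    (∀ (H : Fin N → HilbertSp.{u}) (ρ : (tensorSpace N H).Op) (_ : IsState ρ)
      (_ : StateAdmitsLHV.{u, w} ρ)
      (X : (n : Fin N) → Fin 2 → (H n).Op) (_ : ∀ n s, IsSelfAdjoint (X n s))
      (_ : ∀ n s, ‖X n s‖ ≤ 1),
      ∃ z : ℂ, HasTrace (ρ ∘L bellOp N H X) z ∧ ‖z‖ ≤ 2 ^ (N - 1)) := by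
  obtain ⟨n, rfl⟩ : ∃ n, N = n + 1 + 1 := ⟨N - 2, by omega⟩
  rw [Nat.add_sub_cancel]
  exact ⟨isGreatest_abs_linForm_mkCoeff n, abs_sum_mkCoeff_mul_corr_le n,
    isLUB_abs_sum_mkCoeff_mul_corr n, exists_hasTrace_bellOp_of_admitsLHV n,
    exists_hasTrace_bellOp_of_stateAdmitsLHV n⟩
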